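/- Consider the massless right-moving real or complex scalar field on the line. In a plane-wave coordinate $x$ it is $$\phi(x)=\frac1{\sqrt{2\pi}}\int_0^\infty\frac{dk}{2k}\,\bigl[a(k)e^{-ikx}+b^\dagger(k)e^{ikx}\bigr],\qquad [a(k),a^\dagger(k')]=[b(k),b^\dagger(k')]=2k\,\delta(k-k'),$$ with $b=a$ for the real field and with $b$ independent of $a$ for the complex field, with Hamiltonian $H$ of one-particle energy $k$ and vacuum $\Omega_o$. The vacuum mean $(\Omega_o,A\,\Omega_o)$ and the thermal mean $\langle A\rangle_\beta=\mathrm{Tr}[e^{-\beta H}A]/\mathrm{Tr}[e^{-\beta H}]$, $\beta>0$, of an observable $A$ quadratic in the field are understood as the limits of the corresponding means over the Fock space of the modes $k=2\pi n/L$, $1\le n\le N$, of a box of length $L$, each mode function being damped by $e^{-\delta k/2}$: first $N\to\infty$, then $L\to\infty$, then $\delta\to0^+$ (so that $x'-x$ is read as $x'-x+i0^+$ in two-point functions). Let the incoming coordinate $x$ be related to the outgoing coordinate $y\in\mathbb R$ by $$x(y)=-e^{-y}\ \text{(relativistic black-hole model)},\qquad x(y)=-\log(1+e^{-y})\ \text{(CGHS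 model)},$$ with all parameters of the models normalized ($M=\lambda=1$, $\Delta=x_o^+=0$). Let $\phi(x)$ be the incoming field, with its plane-wave expansion in $x$, and $\hat\phi(y)=\phi(x(y))$ the outgoing field. For $\varepsilon\ne0$ put $$\hat\Theta_\varepsilon(y)=\tfrac12\bigl[\partial_y\hat\phi(y)^\dagger\partial_y\hat\phi(y+\varepsilon)+\partial_y\hat\phi(y+\varepsilon)^\dagger\partial_y\hat\phi(y)\bigr],$$ and let $\Theta_\varepsilon(x)$ be the same expression for $\phi$ in the coordinate $x$. For an incoming state $\omega$ (the incoming vacuum, or the incoming thermal state of inverse temperature $\beta$) the outgoing energy-momentum tensor at $y$ is $$\lim_{\varepsilon\to0}\bigl[\omega(\hat\Theta_\varepsilon(y))-r_\varepsilon\bigr],$$ where $r_\varepsilon$ is either the incoming vacuum mean of $\Theta_\varepsilon(x(y))$ (subtraction scheme), or the mean of $\hat\Theta_\varepsilon(y)$ in the outgoing vacuum, that is, the vacuum of a field with plane-wave expansion in $y$ (normal ordering with respect to the outgoing vacuum). Denote it by $\hat T_o(y)$ for the incoming vacuum and by $\hat T^{Th}_{\beta,in}(y)$ for the incoming thermal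 state. Let $T^{Th}_{\beta,out}$ be the value obtained in the same way for the outgoing thermal state of inverse temperature $\beta$, that is, with $x(y)$ replaced by $y$. **Theorem.** For the real and for the complex field, in both regularization schemes and for every $\beta>0$: 1. $T^{Th}_{\beta,out}$ is well defined, independent of the point, and $T^{Th}_{\beta,out}=\dfrac{\pi}{12\beta^2}$. 2. For both models $\hat T_o(y)$ and $\hat T^{Th}_{\beta,in}(y)$ are well defined for all $y\in\mathbb R$ (all the limits above exist), and $$\hat T^{Th}_{\beta,in}(y)=\hat T_o(y)+x'(y)^2\,\frac{\pi}{12\beta^2}.$$ 3. For both models, independently of $\beta$, $$\lim_{y\to+\infty}\hat T^{Th}_{\beta,in}(y)=T^{Th}_{2\pi,out}=\frac1{48\pi}.$$ 4. For the CGHS model, moreover, $$\lim_{y\to-\infty}\hat T^{Th}_{\beta,in}(y)=T^{Th}_{\beta,out}=\frac{\pi}{12\beta^2}.$$ -/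

import Mathlib

namespace BlackHoleRadiation

open Filter Topology

noncomputable section

/-- The two kinds of massless scalar field. -/
inductive FieldKind where
  | real
  | complex

/-- Number of particle species: a real field has one, a complex field has two
(particles and antiparticles). -/
def FieldKind.species : FieldKind → ℕ
  | .real => 1
  | .complex => 2

/-- The species annihilated by the field. -/
def FieldKind.particle : (K : FieldKind) → Fin K.species
  | .real => (0 : Fin 1)
  | .complex => (0 : Fin 2)

/-- The species created by the field; it is the particle itself when the field is real. -/
def FieldKind.antiparticle : (K : FieldKind) → Fin K.species
  | .real => (0 : Fin 1)
  | .complex => (1 : Fin 2)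

/-- The two black-hole models. -/
inductive Model where
  | relativistic
  | cghs

/-- The (right) incoming coordinate as a function of the outgoing coordinate. -/
def Model.chart : Model → ℝ → ℝ
  | .relativistic => fun y => -Real.exp (-y)
  | .cghs => fun y => -Real.log (1 + Real.exp (-y))

/-! ### Fock space of the right-moving modes `k = 2π/L, 4π/L, …, 2πN/L` in a box of length `L` -/

/-- Labels of the oscillators: a mode and a species. -/
abbrev Osc (K : FieldKind) (N : ℕ) : Type := Fin N × Fin K.species

/-- Occupation numbers. -/
abbrev Occ (K : FieldKind) (N : ℕ) : Type := Osc K N → ℕ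

/-- The (algebraic) Fock space: finite combinations of the orthonormal occupation number vectors. -/
abbrev Fock (K : FieldKind) (N : ℕ) : Type := Occ K N →₀ ℂ

/-- The momentum of the mode `j`. The zero momentum is excluded. -/
def momentum (L : ℝ) (j : ℕ) : ℝ := 2 * Real.pi * ((j : ℝ) + 1) / L

variable {K : FieldKind} {N : ℕ}

/-- The annihilation operator of an oscillator, `a |ν⟩ = √ν |ν - 1⟩`. -/
def annihilate (i : Osc K N) : Module.End ℂ (Fock K N) :=
  Finsupp.linearCombination ℂ fun ν =>
    Finsupp.single (Function.update ν i (ν i - 1)) ((Real.sqrt (ν i : ℝ) : ℝ) : ℂ)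

/-- The creation operator of an oscillator, `a† |ν⟩ = √(ν + 1) |ν + 1⟩`. -/
def create (i : Osc K N) : Module.End ℂ (Fock K N) :=
  Finsupp.linearCombination ℂ fun ν =>
    Finsupp.single (Function.update ν i (ν i + 1)) ((Real.sqrt ((ν i : ℝ) + 1) : ℝ) : ℂ)

/-- The Hamiltonian `H = ∑ k a†a`. -/
def hamiltonian (K : FieldKind) (N : ℕ) (L : ℝ) : Module.End ℂ (Fock K N) :=
  ∑ i : Osc K N, ((momentum L i.1 : ℝ) : ℂ) • (create i * annihilate i)

/-- The energy of an occupation number vector. -/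
def energy (L : ℝ) (ν : Occ K N) : ℝ := ∑ i, momentum L i.1 * (ν i : ℝ)

/-- The occupation number vectors are the eigenvectors of the Hamiltonian. -/
theorem hamiltonian_single (L : ℝ) (ν : Occ K N) :
    hamiltonian K N L (Finsupp.single ν 1) = ((energy L ν : ℝ) : ℂ) • Finsupp.single ν 1 := by
  have key : ∀ i : Osc K N, (create i * annihilate i) (Finsupp.single ν (1 : ℂ))
      = ((ν i : ℝ) : ℂ) • Finsupp.single ν (1 : ℂ) := by
    intro i
    by_cases h : ν i = 0
    · simp [create, annihilate, h]
    · have h1 : ((ν i - 1 : ℕ) : ℝ) + 1 = (ν i : ℝ) := by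
        have : 1 ≤ ν i := Nat.one_le_iff_ne_zero.mpr h
        push_cast [Nat.cast_sub this]; ring
      have h2 : ν i - 1 + 1 = ν i := by omega
      simp only [create, annihilate, Module.End.mul_apply, Finsupp.linearCombination_single,
        one_smul, Function.update_self, Function.update_idem, h1, h2, Function.update_eq_self,
        Finsupp.smul_single, smul_eq_mul, mul_one]
      rw [← Complex.ofReal_mul, Real.mul_self_sqrt (Nat.cast_nonneg _)]
  simp only [hamiltonian, LinearMap.sum_apply, LinearMap.smul_apply, key, energy, smul_smul,
    Complex.ofReal_sum, Complex.ofReal_mul, ← Finset.sum_smul]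

/-- The operator `exp (-βH)`, which acts on the eigenvectors of `H` by `exp (-β · energy)`. -/
def boltzmann (K : FieldKind) (N : ℕ) (L β : ℝ) : Module.End ℂ (Fock K N) :=
  Finsupp.linearCombination ℂ fun ν =>
    Finsupp.single ν ((Real.exp (-β * energy L ν) : ℝ) : ℂ)

/-- The trace over the Fock space, computed in the occupation number basis. -/
def trace (A : Module.End ℂ (Fock K N)) : ℂ := ∑' ν : Occ K N, A (Finsupp.single ν 1) ν

/-- The thermal mean value `Tr [exp (-βH) A] / Tr [exp (-βH)]`. -/
def thermalMean (L β : ℝ) (A : Module.End ℂ (Fock K N)) : ℂ :=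
  trace (boltzmann K N L β * A) / trace (boltzmann K N L β)

/-- The vacuum mean value `(Ω, A Ω)`. -/
def vacuumMean (A : Module.End ℂ (Fock K N)) : ℂ := A (Finsupp.single 0 1) 0

/-! ### The field and its energy-momentum observable -/

/-- The mode function `exp (-ikx) / √(2Lk)`; the ultraviolet damping `exp (-δk/2)` realizes the
prescription `x' - x + i0⁺` in the two-point function as `δ → 0⁺`. -/
def modeFun (δ L : ℝ) (j : ℕ) (x : ℝ) : ℂ :=
  Complex.exp (-Complex.I * (momentum L j : ℂ) * (x : ℂ) - (δ : ℂ) * (momentum L j : ℂ) / 2)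
    / ((Real.sqrt (2 * L * momentum L j) : ℝ) : ℂ)

/-- The operator `∑ (w a + w* b†)`, where `b = a` if the field is real. With
`w j = modeFun δ L j x` it is the field `φ(x)`. -/
def fieldOp (K : FieldKind) {N : ℕ} (w : Fin N → ℂ) : Module.End ℂ (Fock K N) :=
  ∑ j, (w j • annihilate (j, K.particle) + (starRingEnd ℂ (w j)) • create (j, K.antiparticle))

/-- The adjoint of `fieldOp K w`. -/
def fieldOpAdj (K : FieldKind) {N : ℕ} (w : Fin N → ℂ) : Module.End ℂ (Fock K N) :=
  ∑ j, ((starRingEnd ℂ (w j)) • create (j, K.particle) + w j • annihilate (j, K.antiparticle))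

/-- Coefficients of `∂_y` of the field `φ(χ(y))`, where `χ` expresses the coordinate `x` in which
the modes are plane waves through the coordinate `y`. -/
def derivCoeff (χ : ℝ → ℝ) (δ L : ℝ) (N : ℕ) (y : ℝ) : Fin N → ℂ :=
  fun j => deriv (fun z : ℝ => modeFun δ L j (χ z)) y

/-- The point-split energy-momentum observable in the coordinate `y` of the field
`φ' (y) = φ(χ(y))`:
`½ [∂φ'(y)† ∂φ'(y + ε) + ∂φ'(y + ε)† ∂φ'(y)]`. -/
def splitTensor (K : FieldKind) (χ : ℝ → ℝ) (y ε δ L : ℝ) (N : ℕ) : Module.End ℂ (Fock K N) :=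
  (1 / 2 : ℂ) •
    (fieldOpAdj K (derivCoeff χ δ L N y) * fieldOp K (derivCoeff χ δ L N (y + ε))
      + fieldOpAdj K (derivCoeff χ δ L N (y + ε)) * fieldOp K (derivCoeff χ δ L N y))

/-- `a` is the value of the regularized mean `f δ L N` when the cutoffs are removed: first the
number of modes `N → ∞`, next the length of the box `L → ∞`, finally the damping `δ → 0⁺`. -/
def IsCutoffLimit (f : ℝ → ℝ → ℕ → ℂ) (a : ℂ) : Prop :=
  ∃ (g : ℝ → ℝ → ℂ) (h : ℝ → ℂ),
    (∀ δ > 0, ∀ L > 0, Tendsto (f δ L) atTop (𝓝 (g δ L))) ∧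
    (∀ δ > 0, Tendsto (g δ) atTop (𝓝 (h δ))) ∧
    Tendsto h (𝓝[>] 0) (𝓝 a)

/-- The two regularization schemes: normal ordering with respect to the outgoing vacuum, that is,
subtraction of the outgoing vacuum mean value of the same observable at `y`, and subtraction of the
incoming vacuum mean value of the incoming observable at `x(y)`. -/
inductive Scheme where
  | normal
  | subtraction

/-- The point at which the vacuum mean value to be subtracted is taken. -/
def Scheme.refPoint : Scheme → (ℝ → ℝ) → ℝ → ℝ
  | .normal => fun _ y => y
  | .subtraction => fun χ y => χ y

/-- `t` is the limit, as the splitting `ε` of the points tends to `0`, of the mean value of the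
point-split observable minus that of the plane-wave observable in its vacuum. Here `mean ε` is the
family of regularized mean values of the former. -/
def IsRenormalizedValue (K : FieldKind) (s : Scheme) (χ : ℝ → ℝ) (y : ℝ)
    (mean : ℝ → ℝ → ℝ → ℕ → ℂ) (t : ℝ) : Prop :=
  ∃ m v : ℝ → ℂ,
    (∀ ε : ℝ, ε ≠ 0 → IsCutoffLimit (mean ε) (m ε)) ∧
    (∀ ε : ℝ, ε ≠ 0 → IsCutoffLimit
      (fun δ L N => vacuumMean (splitTensor K id (s.refPoint χ y) ε δ L N)) (v ε)) ∧
    Tendsto (fun ε => m ε - v ε) (𝓝[≠] 0) (𝓝 (t : ℂ))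

/-- `t` is the energy-momentum tensor at the point `y`, in the coordinate `y`, of the field in the
thermal state of inverse temperature `β` with respect to the coordinate `x = χ(y)`. -/
def IsThermalTensor (K : FieldKind) (s : Scheme) (β : ℝ) (χ : ℝ → ℝ) (y t : ℝ) : Prop :=
  IsRenormalizedValue K s χ y
    (fun ε δ L N => thermalMean L β (splitTensor K χ y ε δ L N)) t

/-- `t` is the energy-momentum tensor at the point `y`, in the coordinate `y`, of the field in the
vacuum state with respect to the coordinate `x = χ(y)`. -/
def IsVacuumTensor (K : FieldKind) (s : Scheme) (χ : ℝ → ℝ) (y t : ℝ) : Prop :=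
  IsRenormalizedValue K s χ y
    (fun ε δ L N => vacuumMean (splitTensor K χ y ε δ L N)) t

/-- The thermal value `π / (12 β²)` of the energy-momentum tensor. -/
def thermalValue (β : ℝ) : ℝ := Real.pi / (12 * β ^ 2)

end

end BlackHoleRadiation

namespace BlackHoleRadiation

open Filter Topology

/-! ### Mean values of quadratic observables -/

section Fock

variable {K : FieldKind} {N : ℕ}

/-! The diagonal elements of the point-split observable in occupation states are sums over the modes
of $\mathrm{Re}(u_j\bar v_j)$ times (particles + antiparticles + 1), with $u,v$ the mode derivatives
at the two points. The thermal mean of the last factor is $1+2/(e^{\beta k}-1)$ for one species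
counted twice as well as for two independent ones, so the real and the complex field have equal
means (`thermalMean_splitTensor`).

Removing the cutoffs turns the mode sums into momentum integrals (`isCutoffLimit_momentum_sum`).
With $\Delta=\chi(y+\varepsilon)-\chi(y)$, the vacuum part is
$-\chi'(y)\chi'(y+\varepsilon)/(4\pi\Delta^2)$. The thermal part is the cosine transform of the
integrable density $k/(e^{\beta k}-1)$. It is regular at $\Delta=0$, where $\zeta(2)$ yields
$\pi/(12\beta^2)$, multiplied by $\chi'(y)^2$.

Both schemes subtract the same $-1/(4\pi\varepsilon^2)$, because the plane-wave vacuum is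
translation invariant. Taylor expansion leaves $-S(\chi)/(24\pi)$, with $S$ the Schwarzian
derivative (`tendsto_point_splitting`). For the two charts $S=-\frac12$ and $S=-\frac12(1-\chi'^2)$.
As $y\to+\infty$, $\chi'\to0$ erases the dependence on $\beta$ and leaves $1/(48\pi)$, the thermal
value at $\beta=2\pi$. As $y\to-\infty$ in the CGHS model, $\chi'\to1$, so the vacuum part vanishes
and the thermal part survives in full. -/

theorem annihilate_single (i : Osc K N) (ν : Occ K N) (c : ℂ) :
    annihilate i (Finsupp.single ν c) =
      Finsupp.single (Function.update ν i (ν i - 1)) (c * ((Real.sqrt (ν i : ℝ) : ℝ) : ℂ)) := by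
  simp [annihilate]

theorem create_single (i : Osc K N) (ν : Occ K N) (c : ℂ) :
    create i (Finsupp.single ν c) =
      Finsupp.single (Function.update ν i (ν i + 1))
        (c * ((Real.sqrt ((ν i : ℝ) + 1) : ℝ) : ℂ)) := by
  simp [create]

/-- Two creations raise the total occupation number, so nothing returns to the initial state. The
case `i = j` occurs for the real field. -/
theorem create_mul_create_diag (i j : Osc K N) (ν : Occ K N) :
    (create i * create j) (Finsupp.single ν 1) ν = 0 := by
  rw [Module.End.mul_apply, create_single, create_single, Finsupp.single_apply, if_neg]
  intro h
  have := congrFun h i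
  rcases eq_or_ne i j with rfl | hij
  · simp at this; omega
  · simp [hij] at this

theorem annihilate_mul_annihilate_diag (i j : Osc K N) (ν : Occ K N) :
    (annihilate i * annihilate j) (Finsupp.single ν 1) ν = 0 := by
  rw [Module.End.mul_apply, annihilate_single, annihilate_single]
  -- Truncated subtraction would leave an empty oscillator unchanged; there the coefficient $\sqrt0$
  -- gives the zero.
  by_cases h0 : ν j = 0
  · simp [h0]
  rw [Finsupp.single_apply, if_neg]
  intro h
  have := congrFun h j
  rcases eq_or_ne i j with rfl | hij
  · simp at this; omega
  · simp [hij.symm] at this; omega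

theorem create_mul_annihilate_diag (i j : Osc K N) (ν : Occ K N) :
    (create i * annihilate j) (Finsupp.single ν 1) ν = if i = j then (ν i : ℂ) else 0 := by
  rw [Module.End.mul_apply, annihilate_single, create_single]
  split_ifs with hij
  · subst hij
    by_cases h0 : ν i = 0
    · simp [h0]
    have h2 : ν i - 1 + 1 = ν i := by omega
    have h1 : ((ν i - 1 : ℕ) : ℝ) + 1 = (ν i : ℝ) := by exact_mod_cast h2
    simp only [Function.update_self, Function.update_idem, h1, h2, Function.update_eq_self,
      Finsupp.single_eq_same, one_mul]
    rw [← Complex.ofReal_mul, Real.mul_self_sqrt (Nat.cast_nonneg _)]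
    simp
  · rw [Finsupp.single_apply, if_neg]
    intro h
    have := congrFun h i
    simp [hij] at this

theorem annihilate_mul_create_diag (i j : Osc K N) (ν : Occ K N) :
    (annihilate i * create j) (Finsupp.single ν 1) ν = if i = j then (ν i : ℂ) + 1 else 0 := by
  rw [Module.End.mul_apply, create_single, annihilate_single]
  split_ifs with hij
  · subst hij
    simp only [Function.update_self, Function.update_idem, Nat.add_sub_cancel,
      Function.update_eq_self, Finsupp.single_eq_same, one_mul, Nat.cast_add, Nat.cast_one]
    rw [← Complex.ofReal_mul, Real.mul_self_sqrt (by positivity)]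
    simp
  · rw [Finsupp.single_apply, if_neg]
    intro h
    have := congrFun h j
    simp [Ne.symm hij] at this

/-- Diagonal matrix elements of a product of two field operators. -/
theorem fieldOpAdj_mul_fieldOp_diag (u v : Fin N → ℂ) (ν : Occ K N) :
    (fieldOpAdj K u * fieldOp K v) (Finsupp.single ν 1) ν =
      ∑ j, (starRingEnd ℂ (u j) * v j * (ν (j, K.particle) : ℂ)
        + u j * starRingEnd ℂ (v j) * ((ν (j, K.antiparticle) : ℂ) + 1)) := by
  have key : ∀ i j : Fin N,
      (((starRingEnd ℂ (u i)) • create (i, K.particle) + u i • annihilate (i, K.antiparticle)) *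
        (v j • annihilate (j, K.particle) + (starRingEnd ℂ (v j)) • create (j, K.antiparticle)))
        (Finsupp.single ν 1) ν =
      if i = j then (starRingEnd ℂ (u i) * v j * (ν (i, K.particle) : ℂ)
        + u i * starRingEnd ℂ (v j) * ((ν (i, K.antiparticle) : ℂ) + 1)) else 0 := by
    intro i j
    simp only [mul_add, add_mul, smul_mul_smul_comm, LinearMap.add_apply, LinearMap.smul_apply,
      Finsupp.add_apply, Finsupp.smul_apply, create_mul_create_diag,
      annihilate_mul_annihilate_diag, create_mul_annihilate_diag, annihilate_mul_create_diag,
      Prod.mk.injEq, and_true, smul_eq_mul]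
    split_ifs <;> ring
  rw [fieldOpAdj, fieldOp, Finset.sum_mul_sum]
  simp only [LinearMap.sum_apply, Finsupp.finsetSum_apply, key, Finset.sum_ite_eq,
    Finset.mem_univ, if_true]

/-- The diagonal matrix elements of the point-split observable. -/
theorem splitTensor_diag (χ : ℝ → ℝ) (y ε δ L : ℝ) (ν : Occ K N) :
    splitTensor K χ y ε δ L N (Finsupp.single ν 1) ν =
      ∑ j, (((derivCoeff χ δ L N y j * starRingEnd ℂ (derivCoeff χ δ L N (y + ε) j)).re : ℝ) : ℂ) *
        ((ν (j, K.particle) : ℂ) + (ν (j, K.antiparticle) : ℂ) + 1) := by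
  rw [splitTensor, LinearMap.smul_apply, Finsupp.smul_apply, LinearMap.add_apply,
    Finsupp.add_apply, fieldOpAdj_mul_fieldOp_diag, fieldOpAdj_mul_fieldOp_diag,
    ← Finset.sum_add_distrib, smul_eq_mul, Finset.mul_sum]
  refine Finset.sum_congr rfl fun j _ => ?_
  -- The symmetrization in the two points gives both the particle and the antiparticle terms the
  -- same coefficient, half of $u\bar v+\bar u v$.
  rw [Complex.re_eq_add_conj]
  simp only [map_mul, Complex.conj_conj]
  ring

theorem vacuumMean_splitTensor (χ : ℝ → ℝ) (y ε δ L : ℝ) :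
    vacuumMean (splitTensor K χ y ε δ L N) =
      ∑ j, (((derivCoeff χ δ L N y j * starRingEnd ℂ (derivCoeff χ δ L N (y + ε) j)).re : ℝ) : ℂ) := by
  rw [vacuumMean, splitTensor_diag]
  simp

theorem boltzmann_apply (L β : ℝ) (f : Fock K N) (ν : Occ K N) :
    boltzmann K N L β f ν = ((Real.exp (-β * energy L ν) : ℝ) : ℂ) * f ν := by
  induction f using Finsupp.induction_linear with
  | zero => simp
  | add f g hf hg => simp [hf, hg, mul_add]
  | single μ c =>
    simp only [boltzmann, Finsupp.linearCombination_single, Finsupp.smul_single, smul_eq_mul,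
      Finsupp.single_apply]
    split_ifs with h
    · subst h; ring
    · simp

theorem trace_boltzmann_mul (L β : ℝ) (A : Module.End ℂ (Fock K N)) :
    trace (boltzmann K N L β * A) =
      ∑' ν : Occ K N, ((Real.exp (-β * energy L ν) : ℝ) : ℂ) * A (Finsupp.single ν 1) ν := by
  simp only [trace, Module.End.mul_apply, boltzmann_apply]

theorem trace_boltzmann (L β : ℝ) :
    trace (boltzmann K N L β) =
      ∑' ν : Occ K N, ((Real.exp (-β * energy L ν) : ℝ) : ℂ) := by
  simp [trace, boltzmann_apply]

end Fock

/-- A product of nonnegative summable functions of independent discrete variables is summable. -/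
theorem summable_pi_prod {ι : Type*} [Fintype ι] (f : ι → ℕ → ℝ)
    (hf : ∀ i n, 0 ≤ f i n) (hs : ∀ i, Summable (f i)) :
    Summable fun ν : ι → ℕ => ∏ i, f i (ν i) := by
  classical
  refine summable_of_sum_le (c := ∏ i, ∑' n, f i n)
    (fun ν => Finset.prod_nonneg fun i _ => hf i _) fun u => ?_
  -- Every finite set of indices lies in a box, over which the sum of products factorizes.
  have hsub : u ⊆ Fintype.piFinset fun i => u.image fun ν => ν i := by
    intro ν hν
    rw [Fintype.mem_piFinset]
    exact fun i => Finset.mem_image_of_mem (fun ν => ν i) hν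
  calc ∑ ν ∈ u, ∏ i, f i (ν i)
      ≤ ∑ ν ∈ Fintype.piFinset fun i => u.image fun ν => ν i, ∏ i, f i (ν i) :=
        Finset.sum_le_sum_of_subset_of_nonneg hsub
          fun ν _ _ => Finset.prod_nonneg fun i _ => hf i _
    _ = ∏ i, ∑ n ∈ u.image fun ν => ν i, f i n := (Finset.prod_univ_sum _ _).symm
    _ ≤ ∏ i, ∑' n, f i n := Finset.prod_le_prod
        (fun i _ => Finset.sum_nonneg fun n _ => hf i n)
        fun i _ => (hs i).sum_le_tsum _ fun n _ => hf i n

theorem momentum_pos {L : ℝ} (hL : 0 < L) (j : ℕ) : 0 < momentum L j := by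
  unfold momentum; positivity

/-! ### Gibbs sums and thermal occupation numbers -/

section Thermal

variable {K : FieldKind} {N : ℕ} {L β : ℝ}

theorem boltzmann_weight_eq_prod (ν : Occ K N) :
    Real.exp (-β * energy L ν) = ∏ i, Real.exp (-β * momentum L i.1) ^ (ν i) := by
  rw [energy, Finset.mul_sum, Real.exp_sum]
  refine Finset.prod_congr rfl fun i _ => ?_
  rw [← Real.exp_nat_mul]
  ring_nf

theorem boltzmann_factor_lt_one (hL : 0 < L) (hβ : 0 < β) (j : ℕ) :
    Real.exp (-β * momentum L j) < 1 := by
  rw [Real.exp_lt_one_iff]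
  nlinarith [momentum_pos hL j]

theorem summable_boltzmann_weight (hL : 0 < L) (hβ : 0 < β) :
    Summable fun ν : Occ K N => Real.exp (-β * energy L ν) := by
  simp only [boltzmann_weight_eq_prod]
  exact summable_pi_prod
    (fun (i : Osc K N) (n : ℕ) => Real.exp (-β * momentum L i.1) ^ n)
    (fun _ _ => pow_nonneg (Real.exp_pos _).le _) fun i =>
      summable_geometric_of_lt_one (Real.exp_pos _).le (boltzmann_factor_lt_one hL hβ _)

theorem summable_boltzmann_weight_mul (hL : 0 < L) (hβ : 0 < β) (i : Osc K N) :
    Summable fun ν : Occ K N => Real.exp (-β * energy L ν) * (ν i : ℝ) := by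
  -- The factor `ν i` is absorbed into the single factor `l = i`, so that the weight is still a
  -- product over the oscillators.
  have hsum : ∀ l : Osc K N, Summable fun n : ℕ =>
      (if l = i then (n : ℝ) else 1) * Real.exp (-β * momentum L l.1) ^ n := by
    intro l
    have hlt := boltzmann_factor_lt_one hL hβ (l.1 : ℕ)
    have hlt' : ‖Real.exp (-β * momentum L l.1)‖ < 1 := by
      rwa [Real.norm_eq_abs, Real.abs_exp]
    split_ifs
    · simpa only [pow_one] using summable_pow_mul_geometric_of_norm_lt_one 1 hlt'
    · simpa only [one_mul] using summable_geometric_of_lt_one (Real.exp_pos _).le hlt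
  have h := summable_pi_prod
    (fun (l : Osc K N) (n : ℕ) =>
      (if l = i then (n : ℝ) else 1) * Real.exp (-β * momentum L l.1) ^ n)
    (fun l n => by split_ifs <;> positivity) hsum
  refine h.congr fun ν => ?_
  rw [Finset.prod_mul_distrib, boltzmann_weight_eq_prod, mul_comm]
  simp

theorem energy_update_succ (ν : Occ K N) (i : Osc K N) :
    energy L (Function.update ν i (ν i + 1)) = energy L ν + momentum L i.1 := by
  have h : ∀ l, momentum L l.1 * ((Function.update ν i (ν i + 1) l : ℕ) : ℝ)
      = momentum L l.1 * (ν l : ℝ) + if l = i then momentum L l.1 else 0 := by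
    intro l
    rcases eq_or_ne l i with rfl | hl
    · simp; ring
    · simp [hl]
  simp only [energy, h, Finset.sum_add_distrib]
  simp

/-- The Bose–Einstein distribution. -/
theorem tsum_boltzmann_weight_mul (hL : 0 < L) (hβ : 0 < β) (i : Osc K N) :
    ∑' ν : Occ K N, Real.exp (-β * energy L ν) * (ν i : ℝ) =
      (Real.exp (β * momentum L i.1) - 1)⁻¹ * ∑' ν : Occ K N, Real.exp (-β * energy L ν) := by
  set q := Real.exp (-β * momentum L i.1) with hq
  have hS := summable_boltzmann_weight_mul hL hβ i
  have hZ := summable_boltzmann_weight (K := K) (N := N) hL hβ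
  have hinj : Function.Injective fun ν : Occ K N => Function.update ν i (ν i + 1) := by
    intro ν μ h
    funext l
    have hl := congrFun h l
    rcases eq_or_ne l i with rfl | hli
    · simpa using hl
    · simpa [hli] using hl
  have hsupp : Function.support (fun ν : Occ K N => Real.exp (-β * energy L ν) * (ν i : ℝ)) ⊆
      Set.range fun ν : Occ K N => Function.update ν i (ν i + 1) := by
    intro ν hν
    have h0 : ν i ≠ 0 := by
      intro h; simp [h] at hν
    refine ⟨Function.update ν i (ν i - 1), ?_⟩
    have h2 : ν i - 1 + 1 = ν i := by omega
    simp [h2]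
  -- States with `ν i = 0` do not contribute, and the others are shifts by one quantum, each of
  -- which costs a factor $q$. Hence $S=q(S+Z)$, which determines $S/Z$ without evaluating the
  -- partition function $Z$.
  have h1 : ∑' ν : Occ K N, Real.exp (-β * energy L ν) * (ν i : ℝ) =
      q * (∑' ν : Occ K N, Real.exp (-β * energy L ν) * (ν i : ℝ)
        + ∑' ν : Occ K N, Real.exp (-β * energy L ν)) := by
    rw [← hS.tsum_add hZ, ← tsum_mul_left, ← hinj.tsum_eq hsupp]
    refine tsum_congr fun ν => ?_
    simp only [energy_update_succ, Function.update_self, hq, mul_add, Real.exp_add]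
    push_cast
    ring
  have hq1 : q < 1 := boltzmann_factor_lt_one hL hβ _
  have hq0 : 0 < q := Real.exp_pos _
  have hqi : Real.exp (β * momentum L i.1) = q⁻¹ := by
    rw [hq, ← Real.exp_neg]; ring_nf
  have h3 : q⁻¹ - 1 ≠ 0 := by
    have := (one_lt_inv₀ hq0).2 hq1
    linarith
  rw [hqi, eq_inv_mul_iff_mul_eq₀ h3]
  set S := ∑' ν : Occ K N, Real.exp (-β * energy L ν) * (ν i : ℝ)
  have h4 : q⁻¹ * S = S + ∑' ν : Occ K N, Real.exp (-β * energy L ν) := by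
    rw [inv_mul_eq_iff_eq_mul₀ hq0.ne']; exact h1
  linear_combination h4

theorem thermalMean_splitTensor (hL : 0 < L) (hβ : 0 < β) (χ : ℝ → ℝ) (y ε δ : ℝ) :
    thermalMean L β (splitTensor K χ y ε δ L N) =
      ∑ j : Fin N,
        (((derivCoeff χ δ L N y j * starRingEnd ℂ (derivCoeff χ δ L N (y + ε) j)).re *
          (1 + 2 * (Real.exp (β * momentum L j) - 1)⁻¹) : ℝ) : ℂ) := by
  set r : Fin N → ℝ := fun j =>
    (derivCoeff χ δ L N y j * starRingEnd ℂ (derivCoeff χ δ L N (y + ε) j)).re with hr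
  have hZ := summable_boltzmann_weight (K := K) (N := N) hL hβ
  have hZpos : 0 < ∑' ν : Occ K N, Real.exp (-β * energy L ν) :=
    hZ.tsum_pos (fun ν => (Real.exp_pos _).le) 0 (Real.exp_pos _)
  have hS := fun i : Osc K N => summable_boltzmann_weight_mul hL hβ i
  have hterm : ∀ j : Fin N, Summable fun ν : Occ K N =>
      r j * (Real.exp (-β * energy L ν) * (ν (j, K.particle) : ℝ)
        + Real.exp (-β * energy L ν) * (ν (j, K.antiparticle) : ℝ)
        + Real.exp (-β * energy L ν)) := fun j =>
    (((hS _).add (hS _)).add hZ).mul_left _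
  rw [thermalMean, trace_boltzmann_mul, trace_boltzmann]
  have hnum : ∀ ν : Occ K N, ((Real.exp (-β * energy L ν) : ℝ) : ℂ) *
      splitTensor K χ y ε δ L N (Finsupp.single ν 1) ν =
      ((∑ j : Fin N, r j * (Real.exp (-β * energy L ν) * (ν (j, K.particle) : ℝ)
        + Real.exp (-β * energy L ν) * (ν (j, K.antiparticle) : ℝ)
        + Real.exp (-β * energy L ν)) : ℝ) : ℂ) := by
    intro ν
    rw [splitTensor_diag, Finset.mul_sum, Complex.ofReal_sum]
    refine Finset.sum_congr rfl fun j _ => ?_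
    push_cast [hr]
    ring
  rw [tsum_congr hnum, ← Complex.ofReal_tsum, ← Complex.ofReal_tsum, ← Complex.ofReal_div,
    ← Complex.ofReal_sum, Complex.ofReal_inj, Summable.tsum_finsetSum fun j _ => hterm j,
    Finset.sum_div]
  refine Finset.sum_congr rfl fun j _ => ?_
  rw [tsum_mul_left, ((hS _).add (hS _)).tsum_add hZ, (hS _).tsum_add (hS _),
    tsum_boltzmann_weight_mul hL hβ, tsum_boltzmann_weight_mul hL hβ, div_eq_iff hZpos.ne']
  ring

end Thermal

/-! ### Sums over the modes of a box and their infinite-volume limit -/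

section ModeSums

open MeasureTheory Set

variable {f : ℝ → ℝ} {C c : ℝ}

theorem summable_momentum (hc : 0 < c) (hf : ∀ k, 0 < k → |f k| ≤ C * Real.exp (-(c * k)))
    {L : ℝ} (hL : 0 < L) : Summable fun j : ℕ => f (momentum L j) := by
  have hlt : Real.exp (-(c * (2 * Real.pi / L))) < 1 := by
    rw [Real.exp_lt_one_iff]
    have : 0 < c * (2 * Real.pi / L) := by positivity
    linarith
  -- The shift by one matches `momentum`, which has the zero mode removed.
  have hg := ((summable_nat_add_iff 1).2
    (summable_geometric_of_lt_one (Real.exp_pos _).le hlt)).mul_left C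
  refine Summable.of_norm_bounded hg fun j => ?_
  refine (hf _ (momentum_pos hL j)).trans_eq ?_
  rw [← Real.exp_nat_mul]
  congr 2
  unfold momentum
  push_cast
  ring

/-- A mode sum becomes the integral of a step function on a fixed half-line, which makes dominated
convergence available for the infinite-volume limit. -/
theorem integral_nat_floor (G : ℕ → ℝ) {h : ℝ} (hh : 0 < h)
    (hG : IntegrableOn (fun x : ℝ => G ⌊x / h⌋₊) (Ici 0)) :
    ∫ x in Ici (0 : ℝ), G ⌊x / h⌋₊ = h * ∑' j, G j := by
  have hmem : ∀ (j : ℕ) (x : ℝ), x ∈ Ico (j * h) ((j + 1) * h) ↔ 0 ≤ x ∧ ⌊x / h⌋₊ = j := by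
    intro j x
    rw [mem_Ico]
    constructor
    · rintro ⟨h1, h2⟩
      have hx : 0 ≤ x := le_trans (by positivity) h1
      refine ⟨hx, (Nat.floor_eq_iff (by positivity)).2 ⟨?_, ?_⟩⟩
      · rwa [le_div_iff₀ hh]
      · rwa [div_lt_iff₀ hh]
    · rintro ⟨hx, h1⟩
      have := (Nat.floor_eq_iff (by positivity)).1 h1
      rwa [le_div_iff₀ hh, div_lt_iff₀ hh] at this
  have hU : Ici (0 : ℝ) = ⋃ j : ℕ, Ico ((j : ℝ) * h) ((j + 1) * h) := by
    ext x
    simp only [mem_iUnion, hmem, mem_Ici]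
    exact ⟨fun hx => ⟨_, hx, rfl⟩, fun ⟨_, hx, _⟩ => hx⟩
  rw [hU] at hG ⊢
  rw [integral_iUnion (fun _ => measurableSet_Ico) _ hG, ← tsum_mul_left]
  · refine tsum_congr fun j => ?_
    rw [setIntegral_congr_fun (g := fun _ => G j) measurableSet_Ico
      fun x hx => by simp only [((hmem j x).1 hx).2]]
    rw [setIntegral_const, Real.volume_real_Ico_of_le (by nlinarith), smul_eq_mul]
    ring
  · intro i j hij
    rw [Function.onFun, Set.disjoint_left]
    intro x hi hj
    exact hij (((hmem i x).1 hi).2.symm.trans ((hmem j x).1 hj).2)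

/-- Sums over the modes of a box of length `L` become integrals over the momentum. -/
theorem tendsto_momentum_sum (hc : 0 < c) (hcont : ContinuousOn f (Ioi 0))
    (hf : ∀ k, 0 < k → |f k| ≤ C * Real.exp (-(c * k))) :
    Tendsto (fun L : ℝ => 1 / L * ∑' j : ℕ, f (momentum L j)) atTop
      (𝓝 (1 / (2 * Real.pi) * ∫ k in Ioi 0, f k)) := by
  -- Each cell of width $2\pi/L$ is sampled at its right endpoint. The sample point is therefore at
  -- least $x$, and the decreasing exponential at $x$ is a majorant independent of $L$.
  set G : ℝ → ℝ → ℝ := fun L x => f (momentum L ⌊x / (2 * Real.pi / L)⌋₊) with hG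
  have hmeas : ∀ L, Measurable (G L) := fun L =>
    (measurable_from_nat (f := fun n : ℕ => f (momentum L n))).comp
      (Nat.measurable_floor.comp (measurable_id.div_const _))
  have hfloor : ∀ {L : ℝ}, 0 < L → ∀ {x : ℝ}, 0 ≤ x →
      x ≤ momentum L ⌊x / (2 * Real.pi / L)⌋₊ ∧
      momentum L ⌊x / (2 * Real.pi / L)⌋₊ ≤ x + 2 * Real.pi / L := by
    intro L hL x hx
    have hh : 0 < 2 * Real.pi / L := by positivity
    have he : momentum L ⌊x / (2 * Real.pi / L)⌋₊
        = ((⌊x / (2 * Real.pi / L)⌋₊ : ℝ) + 1) * (2 * Real.pi / L) := by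
      unfold momentum; ring
    have h1 := Nat.floor_le (a := x / (2 * Real.pi / L)) (by positivity)
    have h2 := (Nat.lt_floor_add_one (x / (2 * Real.pi / L))).le
    rw [le_div_iff₀ hh] at h1
    rw [div_le_iff₀ hh] at h2
    rw [he]
    exact ⟨h2, by linarith⟩
  have hC : 0 ≤ C := by
    have := (abs_nonneg _).trans (hf 1 one_pos)
    exact nonneg_of_mul_nonneg_left this (Real.exp_pos _)
  have hbound : ∀ {L : ℝ}, 0 < L → ∀ {x : ℝ}, 0 ≤ x → ‖G L x‖ ≤ C * Real.exp (-(c * x)) := by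
    intro L hL x hx
    refine (hf _ (momentum_pos hL _)).trans ?_
    have := (hfloor hL hx).1
    gcongr
  have hint : IntegrableOn (fun x : ℝ => C * Real.exp (-(c * x))) (Ici 0) := by
    rw [integrableOn_Ici_iff_integrableOn_Ioi]
    have := (exp_neg_integrableOn_Ioi 0 hc).const_mul C
    simpa only [neg_mul, IntegrableOn] using this
  have hGint : ∀ {L : ℝ}, 0 < L → IntegrableOn (G L) (Ici 0) := fun hL =>
    Integrable.mono' hint (hmeas _).aestronglyMeasurable
      ((ae_restrict_mem measurableSet_Ici).mono fun x hx => hbound hL hx)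
  have hlim : Tendsto (fun L => ∫ x in Ici (0 : ℝ), G L x) atTop (𝓝 (∫ x in Ici 0, f x)) := by
    refine tendsto_integral_filter_of_dominated_convergence _
      (Eventually.of_forall fun L => (hmeas L).aestronglyMeasurable)
      ((eventually_gt_atTop 0).mono fun L hL =>
        (ae_restrict_mem measurableSet_Ici).mono fun x hx => hbound hL hx) hint ?_
    rw [← restrict_Ioi_eq_restrict_Ici]
    refine (ae_restrict_mem measurableSet_Ioi).mono fun x hx => ?_
    have hx' : (0 : ℝ) < x := hx
    have hm : Tendsto (fun L : ℝ => momentum L ⌊x / (2 * Real.pi / L)⌋₊) atTop (𝓝 x) := by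
      have h0 : Tendsto (fun L : ℝ => x + 2 * Real.pi / L) atTop (𝓝 x) := by
        simpa using (tendsto_const_nhds (x := x)).add
          ((tendsto_const_nhds (x := 2 * Real.pi)).div_atTop tendsto_id)
      refine tendsto_of_tendsto_of_tendsto_of_le_of_le' tendsto_const_nhds h0 ?_ ?_
      · exact (eventually_gt_atTop 0).mono fun L hL => (hfloor hL hx'.le).1
      · exact (eventually_gt_atTop 0).mono fun L hL => (hfloor hL hx'.le).2
    exact ((hcont.continuousAt (Ioi_mem_nhds hx')).tendsto).comp hm
  rw [integral_Ici_eq_integral_Ioi] at hlim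
  refine (hlim.const_mul (1 / (2 * Real.pi))).congr' ?_
  filter_upwards [eventually_gt_atTop 0] with L hL
  have hL0 : L ≠ 0 := hL.ne'
  rw [hG]
  simp only
  rw [integral_nat_floor (fun n => f (momentum L n)) (by positivity) (hGint hL)]
  have := Real.pi_ne_zero
  field_simp

end ModeSums

/-! ### Momentum integrals -/

section Integrals

open MeasureTheory Set

/-- Half of the damping rate is spent on absorbing the factor $k$. -/
theorem mul_exp_neg_le {δ : ℝ} (hδ : 0 < δ) (k : ℝ) :
    k * Real.exp (-(δ * k)) ≤ 2 / δ * Real.exp (-(δ / 2 * k)) := by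
  have h1 : δ / 2 * k ≤ Real.exp (δ / 2 * k) := by
    linarith [Real.add_one_le_exp (δ / 2 * k)]
  have h2 : k ≤ 2 / δ * Real.exp (δ / 2 * k) := by
    rw [div_mul_eq_mul_div, le_div_iff₀ hδ]
    linarith
  calc k * Real.exp (-(δ * k))
      ≤ 2 / δ * Real.exp (δ / 2 * k) * Real.exp (-(δ * k)) := by gcongr
    _ = 2 / δ * Real.exp (-(δ / 2 * k)) := by
      rw [mul_assoc, ← Real.exp_add]
      ring_nf

theorem tendsto_exp_neg_mul_atTop {c : ℝ} (hc : 0 < c) :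
    Tendsto (fun k => Real.exp (-(c * k))) atTop (𝓝 0) :=
  Real.tendsto_exp_neg_atTop_nhds_zero.comp (tendsto_id.const_mul_atTop hc)

/-- The vacuum two-point function with ultraviolet damping. -/
theorem integral_mul_cos_mul_exp {δ : ℝ} (hδ : 0 < δ) (Δ : ℝ) :
    ∫ k in Ioi (0 : ℝ), k * Real.cos (k * Δ) * Real.exp (-(δ * k)) =
      (δ ^ 2 - Δ ^ 2) / (δ ^ 2 + Δ ^ 2) ^ 2 := by
  -- The integral is the real part of $\int_0^\infty k e^{-zk}\,dk=1/z^2$ with $z=\delta-i\Delta$.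
  obtain ⟨z, hz⟩ : ∃ z : ℂ, z = (δ : ℂ) - Δ * Complex.I := ⟨_, rfl⟩
  have hzre : z.re = δ := by simp [hz]
  have hne : z ≠ 0 := fun h => hδ.ne' (by rw [← hzre, h, Complex.zero_re])
  have hnorm : ∀ k : ℝ, ‖Complex.exp (-(z * k))‖ = Real.exp (-(δ * k)) := by
    intro k
    rw [Complex.norm_exp, Complex.neg_re, Complex.re_mul_ofReal, hzre]
  have hint : IntegrableOn (fun k : ℝ => (k : ℂ) * Complex.exp (-(z * k))) (Ioi 0) := by
    have hb := (exp_neg_integrableOn_Ioi 0 (half_pos hδ)).const_mul (2 / δ)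
    refine Integrable.mono' hb (by fun_prop) ?_
    refine (ae_restrict_mem measurableSet_Ioi).mono fun k hk => ?_
    rw [norm_mul, hnorm, Complex.norm_of_nonneg (le_of_lt hk)]
    simpa only [neg_mul] using mul_exp_neg_le hδ k
  have hderiv : ∀ k ∈ Ici (0 : ℝ), HasDerivAt
      (fun k : ℝ => -(1 / z) * (k * Complex.exp (-(z * k))) - 1 / z ^ 2 * Complex.exp (-(z * k)))
      (k * Complex.exp (-(z * k))) k := by
    intro k _
    have h1 : HasDerivAt (fun k : ℝ => (k : ℂ)) 1 k := Complex.ofRealCLM.hasDerivAt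
    have h2 : HasDerivAt (fun k : ℝ => Complex.exp (-(z * k)))
        (Complex.exp (-(z * k)) * -(z * 1)) k := ((h1.const_mul z).neg).cexp
    convert! ((h1.mul h2).const_mul (-(1 / z))).sub (h2.const_mul (1 / z ^ 2)) using 1
    field_simp
    ring
  have hlim : Tendsto (fun k : ℝ => -(1 / z) * (k * Complex.exp (-(z * k)))
      - 1 / z ^ 2 * Complex.exp (-(z * k))) atTop (𝓝 0) := by
    have h1 : Tendsto (fun k : ℝ => Complex.exp (-(z * k))) atTop (𝓝 0) := by
      rw [tendsto_zero_iff_norm_tendsto_zero]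
      simpa only [hnorm] using tendsto_exp_neg_mul_atTop hδ
    have h2 : Tendsto (fun k : ℝ => k * Complex.exp (-(z * k))) atTop (𝓝 0) := by
      have h3 := (tendsto_exp_neg_mul_atTop (half_pos hδ)).const_mul (2 / δ)
      rw [mul_zero] at h3
      refine squeeze_zero_norm' ?_ h3
      filter_upwards [eventually_ge_atTop 0] with k hk
      rw [norm_mul, hnorm, Complex.norm_of_nonneg hk]
      exact mul_exp_neg_le hδ k
    have h3 := (h2.const_mul (-(1 / z))).sub (h1.const_mul (1 / z ^ 2))
    rwa [mul_zero, mul_zero, sub_zero] at h3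
  have h := integral_Ioi_of_hasDerivAt_of_tendsto' hderiv hint hlim
  have hre : ∀ k ∈ Ioi (0 : ℝ), ((k : ℂ) * Complex.exp (-(z * k))).re
      = k * Real.cos (k * Δ) * Real.exp (-(δ * k)) := by
    intro k _
    have e : -(z * k) = ((-(δ * k) : ℝ) : ℂ) + ((k * Δ : ℝ) : ℂ) * Complex.I := by
      rw [hz]; push_cast; ring
    rw [Complex.re_ofReal_mul, e, Complex.exp_add, ← Complex.ofReal_exp, Complex.re_ofReal_mul,
      Complex.exp_ofReal_mul_I_re]
    ring
  rw [← setIntegral_congr_fun measurableSet_Ioi hre]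
  have h1 := integral_re hint
  simp only [RCLike.re_to_complex] at h1
  have hprod : (((δ ^ 2 + Δ ^ 2) ^ 2 : ℝ) : ℂ) = z ^ 2 * ((δ : ℂ) + Δ * Complex.I) ^ 2 := by
    rw [← mul_pow, hz]
    push_cast
    congr 1
    linear_combination (Δ : ℂ) ^ 2 * Complex.I_sq
  have h3 : 1 / z ^ 2 = ((δ : ℂ) + Δ * Complex.I) ^ 2 / (((δ ^ 2 + Δ ^ 2) ^ 2 : ℝ) : ℂ) := by
    have hne' : (((δ ^ 2 + Δ ^ 2) ^ 2 : ℝ) : ℂ) ≠ 0 := by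
      rw [Complex.ofReal_ne_zero]; positivity
    rw [eq_div_iff hne', hprod]
    field_simp
  rw [h1, h]
  simp only [Complex.ofReal_zero, mul_zero, neg_zero, Complex.exp_zero, mul_one,
    zero_sub, sub_neg_eq_add, zero_add]
  rw [h3, Complex.div_ofReal_re]
  congr 1
  simp [pow_two]

variable {β : ℝ}

/-- The thermal spectral density is dominated by an exponential. -/
theorem bose_le (hβ : 0 < β) {k : ℝ} (hk : 0 < k) :
    k * (Real.exp (β * k) - 1)⁻¹ ≤ β⁻¹ * Real.exp (-(β / 2 * k)) := by
  have hx : 0 < β * k := by positivity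
  -- This uses $e^x-1=2e^{x/2}\sinh(x/2)$ together with $\sinh t\ge t$ for $t\ge0$.
  have h1 : β * k ≤ Real.exp (β * k / 2) - Real.exp (-(β * k / 2)) := by
    have := Real.self_le_sinh_iff.2 (by positivity : 0 ≤ β * k / 2)
    rw [Real.sinh_eq] at this
    linarith
  have h2 : Real.exp (β * k) - 1 =
      Real.exp (β * k / 2) * (Real.exp (β * k / 2) - Real.exp (-(β * k / 2))) := by
    rw [mul_sub, ← Real.exp_add, ← Real.exp_add]
    simp only [add_halves, add_neg_cancel, Real.exp_zero]
  have h3 : 0 < Real.exp (β * k / 2) - Real.exp (-(β * k / 2)) := hx.trans_le h1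
  rw [h2, show β / 2 * k = β * k / 2 by ring, Real.exp_neg (β * k / 2)]
  rw [Real.exp_neg] at h1 h3
  have he := Real.exp_pos (β * k / 2)
  rw [mul_inv, ← mul_assoc, mul_comm k, mul_assoc, mul_comm β⁻¹]
  gcongr
  rw [← div_eq_mul_inv, div_le_iff₀ h3, inv_mul_eq_div, le_div_iff₀ hβ]
  linarith

theorem bose_nonneg (hβ : 0 < β) {k : ℝ} (hk : 0 < k) :
    0 ≤ k * (Real.exp (β * k) - 1)⁻¹ := by
  have : 1 < Real.exp (β * k) := Real.one_lt_exp_iff.2 (by positivity)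
  have : 0 < Real.exp (β * k) - 1 := by linarith
  positivity

theorem continuousOn_bose (hβ : 0 < β) :
    ContinuousOn (fun k => k * (Real.exp (β * k) - 1)⁻¹) (Ioi 0) := by
  refine continuousOn_id.mul (ContinuousOn.inv₀ (by fun_prop) fun k hk => ?_)
  have hk' : (0 : ℝ) < k := hk
  have : 1 < Real.exp (β * k) := Real.one_lt_exp_iff.2 (by positivity)
  linarith

/-- The geometric expansion of the Bose factor, integrated term by term, gives
$\beta^{-2}\sum_{n\ge1}n^{-2}$. -/
theorem integral_bose (hβ : 0 < β) :
    ∫ k in Ioi (0 : ℝ), k * (Real.exp (β * k) - 1)⁻¹ = Real.pi ^ 2 / (6 * β ^ 2) := by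
  have hterm : ∀ n : ℕ, 0 < β * (n + 1) := fun n => by positivity
  have hval : ∀ n : ℕ, ∫ k in Ioi (0 : ℝ), k * Real.exp (-(β * (n + 1) * k)) =
      1 / (β * (n + 1)) ^ 2 := by
    intro n
    have h := integral_mul_cos_mul_exp (hterm n) 0
    simp only [mul_zero, Real.cos_zero, mul_one] at h
    rw [h]
    have := (hterm n).ne'
    field_simp
    ring
  have hint : ∀ n : ℕ, IntegrableOn (fun k : ℝ => k * Real.exp (-(β * (n + 1) * k))) (Ioi 0) := by
    intro n
    -- A non-integrable function has integral zero by convention, which contradicts the positive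
    -- value just found.
    by_contra hni
    have h := hval n
    rw [integral_undef hni] at h
    have : 0 < 1 / (β * (n + 1)) ^ 2 := by have := hterm n; positivity
    linarith
  have hnorm : ∀ n : ℕ, ∫ k in Ioi (0 : ℝ), ‖k * Real.exp (-(β * (n + 1) * k))‖ =
      1 / (β * (n + 1)) ^ 2 := by
    intro n
    rw [← hval n]
    refine setIntegral_congr_fun measurableSet_Ioi fun k hk => ?_
    have hk' : (0 : ℝ) < k := hk
    exact Real.norm_of_nonneg (by positivity)
  have hz : HasSum (fun n : ℕ => 1 / (β * ((n : ℝ) + 1)) ^ 2) (Real.pi ^ 2 / (6 * β ^ 2)) := by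
    have h := (hasSum_nat_add_iff' 1).2 hasSum_zeta_two
    have h' := h.mul_left (1 / β ^ 2)
    have e : 1 / β ^ 2 * (Real.pi ^ 2 / 6 - ∑ i ∈ Finset.range 1, 1 / (i : ℝ) ^ 2)
        = Real.pi ^ 2 / (6 * β ^ 2) := by
      simp
      field_simp
    rw [e] at h'
    refine h'.congr_fun ?_
    intro n
    push_cast
    rw [mul_pow]
    field_simp
  have h := hasSum_integral_of_summable_integral_norm hint
    (by simp only [hnorm]; exact hz.summable)
  simp only [hval] at h
  rw [hz.unique h]
  refine setIntegral_congr_fun measurableSet_Ioi fun k hk => ?_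
  have hk' : (0 : ℝ) < k := hk
  have hq : Real.exp (-(β * k)) < 1 := by
    rw [Real.exp_lt_one_iff]
    have : 0 < β * k := by positivity
    linarith
  have hs := (hasSum_geometric_of_lt_one (Real.exp_pos _).le hq).mul_left
    (k * Real.exp (-(β * k)))
  have hs' : HasSum (fun n : ℕ => k * Real.exp (-(β * (n + 1) * k)))
      (k * Real.exp (-(β * k)) * (1 - Real.exp (-(β * k)))⁻¹) := by
    refine hs.congr_fun ?_
    intro n
    rw [← Real.exp_nat_mul, mul_assoc k, ← Real.exp_add]
    ring_nf
  rw [hs'.tsum_eq, mul_assoc]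
  congr 1
  rw [Real.exp_neg]
  have he := Real.exp_pos (β * k)
  have h1 : 1 < Real.exp (β * k) := Real.one_lt_exp_iff.2 (by positivity)
  have h2 : Real.exp (β * k) - 1 ≠ 0 := by linarith
  have h3 : 1 - (Real.exp (β * k))⁻¹ ≠ 0 := by
    have := inv_lt_one_of_one_lt₀ h1
    linarith
  field_simp

end Integrals

/-! ### Removal of the cutoffs -/

/-- The intermediate limits are unconstrained outside $\delta,L>0$, but the next limit sees them
only there. -/
theorem IsCutoffLimit.unique {f : ℝ → ℝ → ℕ → ℂ} {a b : ℂ} (ha : IsCutoffLimit f a)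
    (hb : IsCutoffLimit f b) : a = b := by
  obtain ⟨g, h, hg, hh, hl⟩ := ha
  obtain ⟨g', h', hg', hh', hl'⟩ := hb
  have hhh : ∀ δ > 0, h δ = h' δ := by
    intro δ hδ
    refine tendsto_nhds_unique_of_eventuallyEq (hh δ hδ) (hh' δ hδ) ?_
    filter_upwards [eventually_gt_atTop 0] with L hL
    exact tendsto_nhds_unique (hg δ hδ L hL) (hg' δ hδ L hL)
  exact tendsto_nhds_unique_of_eventuallyEq hl hl'
    (eventually_mem_nhdsWithin.mono fun δ hδ => hhh δ hδ)

theorem IsCutoffLimit.add {f f' : ℝ → ℝ → ℕ → ℂ} {a b : ℂ} (ha : IsCutoffLimit f a)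
    (hb : IsCutoffLimit f' b) : IsCutoffLimit (fun δ L N => f δ L N + f' δ L N) (a + b) := by
  obtain ⟨g, h, hg, hh, hl⟩ := ha
  obtain ⟨g', h', hg', hh', hl'⟩ := hb
  exact ⟨fun δ L => g δ L + g' δ L, fun δ => h δ + h' δ,
    fun δ hδ L hL => (hg δ hδ L hL).add (hg' δ hδ L hL),
    fun δ hδ => (hh δ hδ).add (hh' δ hδ), hl.add hl'⟩

theorem IsCutoffLimit.congr {f f' : ℝ → ℝ → ℕ → ℂ} {a : ℂ} (ha : IsCutoffLimit f a)
    (hf : ∀ δ > 0, ∀ L > 0, ∀ N, f δ L N = f' δ L N) : IsCutoffLimit f' a := by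
  obtain ⟨g, h, hg, hh, hl⟩ := ha
  exact ⟨g, h, fun δ hδ L hL => (hg δ hδ L hL).congr fun N => hf δ hδ L hL N, hh, hl⟩

/-- The cutoff limit of a sum over the modes. -/
theorem isCutoffLimit_momentum_sum {F : ℝ → ℝ → ℝ} {a : ℝ}
    (hcont : ∀ δ > 0, ContinuousOn (F δ) (Set.Ioi 0))
    (hbound : ∀ δ > 0, ∃ C c : ℝ, 0 < c ∧ ∀ k, 0 < k → |F δ k| ≤ C * Real.exp (-(c * k)))
    (hlim : Tendsto (fun δ => ∫ k in Set.Ioi 0, F δ k) (𝓝[>] 0) (𝓝 a)) (A : ℝ) :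
    IsCutoffLimit (fun δ L N => ((A * (1 / L * ∑ j : Fin N, F δ (momentum L j)) : ℝ) : ℂ))
      ((A * (1 / (2 * Real.pi) * a) : ℝ) : ℂ) := by
  refine ⟨fun δ L => ((A * (1 / L * ∑' j : ℕ, F δ (momentum L j)) : ℝ) : ℂ),
    fun δ => ((A * (1 / (2 * Real.pi) * ∫ k in Set.Ioi 0, F δ k) : ℝ) : ℂ), ?_, ?_, ?_⟩
  · intro δ hδ L hL
    obtain ⟨C, c, hc, hb⟩ := hbound δ hδ
    refine (Complex.continuous_ofReal.tendsto _).comp (Tendsto.const_mul _ (Tendsto.const_mul _ ?_))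
    refine (summable_momentum hc hb hL).hasSum.tendsto_sum_nat.congr fun N => ?_
    exact (Fin.sum_univ_eq_sum_range (fun j => F δ (momentum L j)) N).symm
  · intro δ hδ
    obtain ⟨C, c, hc, hb⟩ := hbound δ hδ
    exact (Complex.continuous_ofReal.tendsto _).comp
      ((tendsto_momentum_sum hc (hcont δ hδ) hb).const_mul _)
  · exact (Complex.continuous_ofReal.tendsto _).comp ((hlim.const_mul _).const_mul _)

/-! ### Two-point functions -/

theorem derivCoeff_eq {χ : ℝ → ℝ} {d y : ℝ} (hχ : HasDerivAt χ d y) (δ L : ℝ) {N : ℕ}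
    (j : Fin N) :
    derivCoeff χ δ L N y j = d * (-Complex.I * (momentum L j : ℂ)) * modeFun δ L j (χ y) := by
  have h1 : HasDerivAt (fun z : ℝ => ((χ z : ℝ) : ℂ)) (d : ℂ) y := hχ.ofReal_comp
  have h2 := (((h1.const_mul (-Complex.I * (momentum L j : ℂ))).sub_const
    ((δ : ℂ) * (momentum L j : ℂ) / 2)).cexp).div_const
    ((Real.sqrt (2 * L * momentum L j) : ℝ) : ℂ)
  have h3 : derivCoeff χ δ L N y j = _ := h2.deriv
  rw [h3, modeFun]
  ring

/-- The two derivatives contribute $k^2$ and the normalization $1/(2Lk)$, leaving $k/(2L)$; the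
phases combine into a function of the coordinate difference. -/
theorem derivCoeff_mul_conj_re {χ : ℝ → ℝ} {d d' y y' : ℝ} (hχ : HasDerivAt χ d y)
    (hχ' : HasDerivAt χ d' y') (δ : ℝ) {L : ℝ} (hL : 0 < L) {N : ℕ} (j : Fin N) :
    (derivCoeff χ δ L N y j * starRingEnd ℂ (derivCoeff χ δ L N y' j)).re =
      d * d' / 2 * (1 / L * (momentum L j * Real.cos (momentum L j * (χ y' - χ y)) *
        Real.exp (-(δ * momentum L j)))) := by
  rw [derivCoeff_eq hχ, derivCoeff_eq hχ', modeFun, modeFun]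
  set k := momentum L j
  have hk : 0 < k := momentum_pos hL j
  have hs : (((Real.sqrt (2 * L * k) : ℝ) : ℂ)) * ((Real.sqrt (2 * L * k) : ℝ) : ℂ)
      = ((2 * L * k : ℝ) : ℂ) := by
    rw [← Complex.ofReal_mul, Real.mul_self_sqrt (by positivity)]
  have he : Complex.exp (-Complex.I * k * (χ y : ℂ) - δ * k / 2) *
      Complex.exp (Complex.I * k * (χ y' : ℂ) - δ * k / 2) =
      ((Real.exp (-(δ * k)) : ℝ) : ℂ) *
        Complex.exp (((k * (χ y' - χ y) : ℝ) : ℂ) * Complex.I) := by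
    rw [← Complex.exp_add, Complex.ofReal_exp, ← Complex.exp_add]
    congr 1
    push_cast
    ring
  have hc : starRingEnd ℂ (Complex.exp (-Complex.I * k * (χ y' : ℂ) - δ * k / 2)) =
      Complex.exp (Complex.I * k * (χ y' : ℂ) - δ * k / 2) := by
    rw [← Complex.exp_conj]
    simp [map_ofNat]
  have hp : (d : ℂ) * (-Complex.I * k) *
      (Complex.exp (-Complex.I * k * (χ y : ℂ) - δ * k / 2) / ((Real.sqrt (2 * L * k) : ℝ) : ℂ)) *
      starRingEnd ℂ ((d' : ℂ) * (-Complex.I * k) *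
      (Complex.exp (-Complex.I * k * (χ y' : ℂ) - δ * k / 2) / ((Real.sqrt (2 * L * k) : ℝ) : ℂ)))
      = ((d * d' * k ^ 2 / (2 * L * k) * Real.exp (-(δ * k)) : ℝ) : ℂ) *
        Complex.exp (((k * (χ y' - χ y) : ℝ) : ℂ) * Complex.I) := by
    simp only [map_mul, map_div₀, map_neg, Complex.conj_I, Complex.conj_ofReal, hc]
    calc _ = (d * d' * k ^ 2 * -(Complex.I ^ 2)) *
        (Complex.exp (-Complex.I * k * (χ y : ℂ) - δ * k / 2) *
          Complex.exp (Complex.I * k * (χ y' : ℂ) - δ * k / 2)) /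
        (((Real.sqrt (2 * L * k) : ℝ) : ℂ) * ((Real.sqrt (2 * L * k) : ℝ) : ℂ)) := by
          rw [← div_mul_div_comm]; ring
      _ = _ := by
        rw [he, hs, Complex.I_sq]
        push_cast
        ring
  rw [hp, Complex.re_ofReal_mul, Complex.exp_ofReal_mul_I_re]
  field_simp

section TwoPoint

variable {K : FieldKind} {χ : ℝ → ℝ} {d d' y ε : ℝ}

/-- For separated points the damped integral tends to $-1/\Delta^2$. The prefactor is
$\frac12\cdot\frac1{2\pi}$, from the mode normalization and the density of modes. -/
theorem isCutoffLimit_vacuumMean (hχ : HasDerivAt χ d y) (hχ' : HasDerivAt χ d' (y + ε))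
    (hne : χ (y + ε) ≠ χ y) :
    IsCutoffLimit (fun δ L N => vacuumMean (splitTensor K χ y ε δ L N))
      ((-(d * d' / (4 * Real.pi * (χ (y + ε) - χ y) ^ 2)) : ℝ) : ℂ) := by
  have hΔ : χ (y + ε) - χ y ≠ 0 := sub_ne_zero.2 hne
  have hlim : Tendsto (fun δ => ∫ k in Set.Ioi (0 : ℝ),
      k * Real.cos (k * (χ (y + ε) - χ y)) * Real.exp (-(δ * k))) (𝓝[>] 0)
      (𝓝 (-(1 / (χ (y + ε) - χ y) ^ 2))) := by
    have h1 : Tendsto (fun δ : ℝ => (δ ^ 2 - (χ (y + ε) - χ y) ^ 2) /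
        (δ ^ 2 + (χ (y + ε) - χ y) ^ 2) ^ 2) (𝓝 0) (𝓝 (-(1 / (χ (y + ε) - χ y) ^ 2))) := by
      have h2 : ContinuousAt (fun δ : ℝ => (δ ^ 2 - (χ (y + ε) - χ y) ^ 2) /
          (δ ^ 2 + (χ (y + ε) - χ y) ^ 2) ^ 2) 0 := by
        refine ContinuousAt.div (by fun_prop) (by fun_prop) ?_
        positivity
      have h3 := h2.tendsto
      convert! h3 using 2
      field_simp
      ring
    refine (h1.mono_left nhdsWithin_le_nhds).congr' ?_
    filter_upwards [eventually_mem_nhdsWithin] with δ hδ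
    exact (integral_mul_cos_mul_exp hδ _).symm
  have h := isCutoffLimit_momentum_sum (fun δ _ => by fun_prop) (fun δ hδ => ⟨2 / δ, δ / 2,
    half_pos hδ, fun k hk => by
      refine le_trans ?_ (mul_exp_neg_le hδ k)
      rw [abs_mul, abs_mul, abs_of_pos hk, Real.abs_exp]
      gcongr
      exact mul_le_of_le_one_right hk.le (Real.abs_cos_le_one _)⟩) hlim (d * d' / 2)
  convert! h.congr _ using 1
  · rw [Complex.ofReal_inj]
    have := Real.pi_ne_zero
    field_simp
    ring
  · intro δ _ L hL N
    rw [vacuumMean_splitTensor, ← Complex.ofReal_sum, Complex.ofReal_inj, Finset.mul_sum,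
      Finset.mul_sum]
    exact Finset.sum_congr rfl fun j _ => (derivCoeff_mul_conj_re hχ hχ' δ hL j).symm

variable {β : ℝ}

open MeasureTheory Set in
theorem integrable_bose_bound (hβ : 0 < β) :
    IntegrableOn (fun k : ℝ => β⁻¹ * Real.exp (-(β / 2 * k))) (Ioi 0) := by
  have := (exp_neg_integrableOn_Ioi 0 (half_pos hβ)).const_mul β⁻¹
  simpa only [neg_mul, IntegrableOn] using this

/-- The thermal part of the two-point function at separation `Δ`. -/
noncomputable def thermalKernel (β Δ : ℝ) : ℝ :=
  ∫ k in Set.Ioi (0 : ℝ), k * (Real.exp (β * k) - 1)⁻¹ * Real.cos (k * Δ)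

open MeasureTheory Set in
-- The Bose density is integrable, so the thermal part is continuous at coinciding points and needs
-- no subtraction.
theorem tendsto_thermalKernel (hβ : 0 < β) :
    Tendsto (thermalKernel β) (𝓝 0) (𝓝 (Real.pi ^ 2 / (6 * β ^ 2))) := by
  rw [← integral_bose hβ]
  refine tendsto_integral_filter_of_dominated_convergence _ (Eventually.of_forall fun Δ => ?_)
    (Eventually.of_forall fun Δ => ?_) (integrable_bose_bound hβ) ?_
  · exact (((continuousOn_bose hβ).mul (by fun_prop)).aestronglyMeasurable measurableSet_Ioi)
  · refine (ae_restrict_mem measurableSet_Ioi).mono fun k hk => ?_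
    rw [norm_mul, Real.norm_of_nonneg (bose_nonneg hβ hk)]
    exact (mul_le_of_le_one_right (bose_nonneg hβ hk) (Real.abs_cos_le_one _)).trans
      (bose_le hβ hk)
  · refine Eventually.of_forall fun k => ?_
    have h : Continuous fun Δ : ℝ => k * (Real.exp (β * k) - 1)⁻¹ * Real.cos (k * Δ) := by
      fun_prop
    simpa using h.tendsto 0

theorem abs_thermal_density_le (hβ : 0 < β) (Δ : ℝ) {δ k : ℝ} (hδ : 0 < δ) (hk : 0 < k) :
    |k * (Real.exp (β * k) - 1)⁻¹ * Real.cos (k * Δ) * Real.exp (-(δ * k))| ≤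
      β⁻¹ * Real.exp (-(β / 2 * k)) := by
  rw [abs_mul, abs_mul, abs_of_nonneg (bose_nonneg hβ hk), Real.abs_exp]
  refine le_trans ?_ (bose_le hβ hk)
  have h1 : Real.exp (-(δ * k)) ≤ 1 := by
    rw [Real.exp_le_one_iff]
    have : 0 < δ * k := by positivity
    linarith
  rw [mul_assoc]
  exact mul_le_of_le_one_right (bose_nonneg hβ hk)
    (mul_le_one₀ (Real.abs_cos_le_one _) (Real.exp_pos _).le h1)

open MeasureTheory Set in
theorem tendsto_damped_thermalKernel (hβ : 0 < β) (Δ : ℝ) :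
    Tendsto (fun δ => ∫ k in Ioi (0 : ℝ),
      k * (Real.exp (β * k) - 1)⁻¹ * Real.cos (k * Δ) * Real.exp (-(δ * k)))
      (𝓝[>] 0) (𝓝 (thermalKernel β Δ)) := by
  refine tendsto_integral_filter_of_dominated_convergence _ (Eventually.of_forall fun δ => ?_)
    (eventually_mem_nhdsWithin.mono fun δ hδ => ?_) (integrable_bose_bound hβ) ?_
  · exact ((((continuousOn_bose hβ).mul (by fun_prop)).mul
      (by fun_prop)).aestronglyMeasurable measurableSet_Ioi)
  · exact (ae_restrict_mem measurableSet_Ioi).mono fun k hk => abs_thermal_density_le hβ Δ hδ hk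
  · refine Eventually.of_forall fun k => ?_
    have h : Continuous fun δ : ℝ =>
        k * (Real.exp (β * k) - 1)⁻¹ * Real.cos (k * Δ) * Real.exp (-(δ * k)) := by
      fun_prop
    simpa using (h.tendsto 0).mono_left nhdsWithin_le_nhds

/-- The factor $1+2n$ separates the vacuum mean from a regular part, in which the 2 cancels the
$\frac12$ of the mode normalization. -/
theorem isCutoffLimit_thermalMean (hβ : 0 < β) (hχ : HasDerivAt χ d y)
    (hχ' : HasDerivAt χ d' (y + ε)) (hne : χ (y + ε) ≠ χ y) :
    IsCutoffLimit (fun δ L N => thermalMean L β (splitTensor K χ y ε δ L N))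
      ((-(d * d' / (4 * Real.pi * (χ (y + ε) - χ y) ^ 2)) +
        d * d' * (1 / (2 * Real.pi) * thermalKernel β (χ (y + ε) - χ y)) : ℝ) : ℂ) := by
  have h := isCutoffLimit_momentum_sum
    (F := fun δ k => k * (Real.exp (β * k) - 1)⁻¹ * Real.cos (k * (χ (y + ε) - χ y)) *
      Real.exp (-(δ * k)))
    (fun δ _ => ((continuousOn_bose hβ).mul (by fun_prop)).mul (by fun_prop))
    (fun δ hδ => ⟨β⁻¹, β / 2, half_pos hβ, fun k hk => abs_thermal_density_le hβ _ hδ hk⟩)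
    (tendsto_damped_thermalKernel hβ (χ (y + ε) - χ y)) (d * d')
  rw [Complex.ofReal_add]
  refine ((isCutoffLimit_vacuumMean (K := K) hχ hχ' hne).add h).congr ?_
  intro δ _ L hL N
  rw [vacuumMean_splitTensor, thermalMean_splitTensor hL hβ, ← Complex.ofReal_sum,
    ← Complex.ofReal_sum, ← Complex.ofReal_add, Complex.ofReal_inj, Finset.mul_sum,
    Finset.mul_sum, ← Finset.sum_add_distrib]
  refine Finset.sum_congr rfl fun j _ => ?_
  rw [derivCoeff_mul_conj_re hχ hχ' δ hL j]
  ring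

end TwoPoint

/-! ### The limit of coinciding points -/

/-- The reference mean does not depend on the point at which it is taken, so the scheme plays no
role. Uniqueness of cutoff limits gives the forward direction. -/
theorem isRenormalizedValue_iff {K : FieldKind} {s : Scheme} {χ : ℝ → ℝ} {y t₀ : ℝ}
    {mean : ℝ → ℝ → ℝ → ℕ → ℂ} {m : ℝ → ℝ}
    (hm : ∀ ε : ℝ, ε ≠ 0 → IsCutoffLimit (mean ε) (m ε : ℂ))
    (hlim : Tendsto (fun ε => m ε + 1 / (4 * Real.pi * ε ^ 2)) (𝓝[≠] 0) (𝓝 t₀)) (t : ℝ) :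
    IsRenormalizedValue K s χ y mean t ↔ t = t₀ := by
  have hv : ∀ ε : ℝ, ε ≠ 0 → IsCutoffLimit
      (fun δ L N => vacuumMean (splitTensor K id (s.refPoint χ y) ε δ L N))
      ((-(1 / (4 * Real.pi * ε ^ 2)) : ℝ) : ℂ) := by
    intro ε hε
    have h := isCutoffLimit_vacuumMean (K := K) (hasDerivAt_id (s.refPoint χ y))
      (hasDerivAt_id (s.refPoint χ y + ε)) (by simpa using hε)
    simpa using h
  have hlim' : Tendsto (fun ε : ℝ => (m ε : ℂ) - ((-(1 / (4 * Real.pi * ε ^ 2)) : ℝ) : ℂ))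
      (𝓝[≠] 0) (𝓝 (t₀ : ℂ)) := by
    refine ((Complex.continuous_ofReal.tendsto _).comp hlim).congr fun ε => ?_
    simp
  constructor
  · rintro ⟨m', v', hm', hv', ht⟩
    rw [← Complex.ofReal_inj]
    refine tendsto_nhds_unique_of_eventuallyEq ht hlim' ?_
    filter_upwards [eventually_mem_nhdsWithin] with ε hε
    rw [(hm' ε hε).unique (hm ε hε), (hv' ε hε).unique (hv ε hε)]
  · rintro rfl
    exact ⟨fun ε => m ε, _, hm, hv, hlim'⟩

/-- The Schwarzian derivative `c / a - 3/2 (b / a)²` of a function with first, second and third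
derivatives `a`, `b` and `c`. -/
noncomputable def schwarzian (a b c : ℝ) : ℝ := c / a - 3 / 2 * (b / a) ^ 2

/-! ### Taylor expansion of the point-split two-point function -/

section Schwarzian

variable {χ χ₁ χ₂ : ℝ → ℝ} {c y : ℝ}

/-- One application of l'Hôpital's rule leaves the difference quotient of `χ₂`, so the third
derivative is needed only at `y`. -/
theorem tendsto_deriv_taylor_two (h₁ : ∀ z, HasDerivAt χ₁ (χ₂ z) z) (h₂ : HasDerivAt χ₂ c y) :
    Tendsto (fun ε => (χ₁ (y + ε) - χ₁ y - χ₂ y * ε) / ε ^ 2) (𝓝[≠] 0) (𝓝 (c / 2)) := by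
  have hs : ∀ ε, HasDerivAt (fun ε => χ₁ (y + ε)) (χ₂ (y + ε)) ε := fun ε => by
    simpa using (h₁ (y + ε)).comp_const_add y ε
  refine HasDerivAt.lhopital_zero_nhdsNE (f' := fun ε => χ₂ (y + ε) - χ₂ y)
    (g' := fun ε => 2 * ε) (Eventually.of_forall fun ε => ?_) (Eventually.of_forall fun ε => ?_)
    ?_ ?_ ?_ ?_
  · convert! ((hs ε).sub_const (χ₁ y)).sub ((hasDerivAt_id ε).const_mul (χ₂ y)) using 1
    rw [mul_one]
  · simpa using hasDerivAt_pow 2 ε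
  · filter_upwards [eventually_mem_nhdsWithin] with ε hε
    exact mul_ne_zero two_ne_zero hε
  · have hcont : ContinuousAt (fun ε => χ₁ (y + ε) - χ₁ y - χ₂ y * ε) 0 :=
      ((hs 0).continuousAt.sub continuousAt_const).sub (by fun_prop)
    simpa using hcont.tendsto.mono_left nhdsWithin_le_nhds
  · have hcont : ContinuousAt (fun ε : ℝ => ε ^ 2) 0 := by fun_prop
    simpa using hcont.tendsto.mono_left nhdsWithin_le_nhds
  · have h := (hasDerivAt_iff_tendsto_slope_zero.1 h₂).div_const 2
    refine h.congr' ?_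
    filter_upwards [eventually_mem_nhdsWithin] with ε hε
    have hε' : ε ≠ 0 := hε
    rw [smul_eq_mul]
    field_simp

theorem tendsto_taylor_three (h₀ : ∀ z, HasDerivAt χ (χ₁ z) z)
    (h₁ : ∀ z, HasDerivAt χ₁ (χ₂ z) z) (h₂ : HasDerivAt χ₂ c y) :
    Tendsto (fun ε => (χ (y + ε) - χ y - χ₁ y * ε - χ₂ y / 2 * ε ^ 2) / ε ^ 3) (𝓝[≠] 0)
      (𝓝 (c / 6)) := by
  have hs : ∀ ε, HasDerivAt (fun ε => χ (y + ε)) (χ₁ (y + ε)) ε := fun ε => by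
    simpa using (h₀ (y + ε)).comp_const_add y ε
  refine HasDerivAt.lhopital_zero_nhdsNE (f' := fun ε => χ₁ (y + ε) - χ₁ y - χ₂ y * ε)
    (g' := fun ε => 3 * ε ^ 2) (Eventually.of_forall fun ε => ?_)
    (Eventually.of_forall fun ε => ?_) ?_ ?_ ?_ ?_
  · convert! (((hs ε).sub_const (χ y)).sub ((hasDerivAt_id ε).const_mul (χ₁ y))).sub
      ((hasDerivAt_pow 2 ε).const_mul (χ₂ y / 2)) using 1
    simp
    ring
  · simpa using hasDerivAt_pow 3 ε
  · filter_upwards [eventually_mem_nhdsWithin] with ε hε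
    have hε' : ε ≠ 0 := hε
    positivity
  · have hcont : ContinuousAt (fun ε => χ (y + ε) - χ y - χ₁ y * ε - χ₂ y / 2 * ε ^ 2) 0 :=
      (((hs 0).continuousAt.sub continuousAt_const).sub (by fun_prop)).sub (by fun_prop)
    simpa using hcont.tendsto.mono_left nhdsWithin_le_nhds
  · have hcont : ContinuousAt (fun ε : ℝ => ε ^ 3) 0 := by fun_prop
    simpa using hcont.tendsto.mono_left nhdsWithin_le_nhds
  · have h := (tendsto_deriv_taylor_two h₁ h₂).div_const 3
    rw [show c / 2 / 3 = c / 6 by ring] at h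
    refine h.congr fun ε => ?_
    rw [div_div, mul_comm (ε ^ 2)]

/-- Point splitting produces the Schwarzian derivative. -/
theorem tendsto_point_splitting (h₀ : ∀ z, HasDerivAt χ (χ₁ z) z)
    (h₁ : ∀ z, HasDerivAt χ₁ (χ₂ z) z) (h₂ : HasDerivAt χ₂ c y) (hinj : Function.Injective χ)
    (ha : χ₁ y ≠ 0) :
    Tendsto (fun ε => χ₁ y * χ₁ (y + ε) / (χ (y + ε) - χ y) ^ 2 - 1 / ε ^ 2) (𝓝[≠] 0)
      (𝓝 (schwarzian (χ₁ y) (χ₂ y) c / 6)) := by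
  set a := χ₁ y
  set b := χ₂ y
  have hs := tendsto_deriv_taylor_two h₁ h₂
  have hr := tendsto_taylor_three h₀ h₁ h₂
  set s : ℝ → ℝ := fun ε => (χ₁ (y + ε) - a - b * ε) / ε ^ 2 with hsdef
  set r : ℝ → ℝ := fun ε => (χ (y + ε) - χ y - a * ε - b / 2 * ε ^ 2) / ε ^ 3 with hrdef
  have he : Tendsto (fun ε : ℝ => ε) (𝓝[≠] 0) (𝓝 0) := tendsto_id.mono_left nhdsWithin_le_nhds
  have hD : Tendsto (fun ε => a + b / 2 * ε + r ε * ε ^ 2) (𝓝[≠] 0) (𝓝 a) := by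
    simpa using ((tendsto_const_nhds (x := a)).add (he.const_mul (b / 2))).add (hr.mul (he.pow 2))
  -- With $D=a+\frac b2\varepsilon+r\varepsilon^2$ this is
  -- $(a\,\chi_1(y+\varepsilon)-D^2)/\varepsilon^2$: the terms $a^2$ and $ab\varepsilon$ cancel. Its
  -- limit is $ac/6-b^2/4$.
  have hnum : Tendsto (fun ε => a * s ε - b ^ 2 / 4 - 2 * a * r ε - b * ε * r ε - (r ε * ε) ^ 2)
      (𝓝[≠] 0) (𝓝 (a * (c / 2) - b ^ 2 / 4 - 2 * a * (c / 6) - b * 0 * (c / 6)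
        - (c / 6 * 0) ^ 2)) :=
    ((((hs.const_mul a).sub_const _).sub (hr.const_mul _)).sub ((he.const_mul b).mul hr)).sub
      ((hr.mul he).pow 2)
  have hlim := hnum.div (hD.pow 2) (pow_ne_zero 2 ha)
  have hval : (a * (c / 2) - b ^ 2 / 4 - 2 * a * (c / 6) - b * 0 * (c / 6)
        - (c / 6 * 0) ^ 2) / a ^ 2 = schwarzian a b c / 6 := by
    unfold schwarzian
    field_simp
    ring
  rw [hval] at hlim
  refine hlim.congr' ?_
  filter_upwards [eventually_mem_nhdsWithin] with ε hε
  have hε' : ε ≠ 0 := hε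
  have hΔ : χ (y + ε) - χ y ≠ 0 := by
    rw [sub_ne_zero]
    intro h
    exact hε' (by simpa using hinj h)
  have e1 : χ₁ (y + ε) = a + b * ε + s ε * ε ^ 2 := by
    simp only [hsdef]; field_simp; ring
  have e2 : χ (y + ε) - χ y = ε * (a + b / 2 * ε + r ε * ε ^ 2) := by
    simp only [hrdef]; field_simp; ring
  have hD0 : a + b / 2 * ε + r ε * ε ^ 2 ≠ 0 := fun h => hΔ (by rw [e2, h, mul_zero])
  rw [e1, e2, Pi.div_apply]
  generalize s ε = S at *
  generalize r ε = R at *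
  rw [div_sub_div _ _ (pow_ne_zero 2 (mul_ne_zero hε' hD0)) (pow_ne_zero 2 hε'),
    div_eq_div_iff (pow_ne_zero 2 hD0)
      (mul_ne_zero (pow_ne_zero 2 (mul_ne_zero hε' hD0)) (pow_ne_zero 2 hε'))]
  ring

variable {K : FieldKind} {s : Scheme}

/-- The vacuum energy-momentum tensor is given by the Schwarzian derivative of the chart. -/
theorem isVacuumTensor_iff (h₀ : ∀ z, HasDerivAt χ (χ₁ z) z)
    (h₁ : ∀ z, HasDerivAt χ₁ (χ₂ z) z) (h₂ : HasDerivAt χ₂ c y) (hinj : Function.Injective χ)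
    (ha : χ₁ y ≠ 0) (t : ℝ) :
    IsVacuumTensor K s χ y t ↔ t = -(schwarzian (χ₁ y) (χ₂ y) c / (24 * Real.pi)) := by
  refine isRenormalizedValue_iff (fun ε hε => isCutoffLimit_vacuumMean (h₀ y) (h₀ (y + ε))
    fun h => hε (by simpa using hinj h)) ?_ t
  have h := (tendsto_point_splitting h₀ h₁ h₂ hinj ha).const_mul (-(1 / (4 * Real.pi)))
  convert! h using 1
  · funext ε
    rw [mul_sub, mul_assoc, ← div_div, ← div_div]
    ring
  · congr 1
    ring

/-- The thermal energy-momentum tensor. -/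
theorem isThermalTensor_iff {β : ℝ} (hβ : 0 < β) (h₀ : ∀ z, HasDerivAt χ (χ₁ z) z)
    (h₁ : ∀ z, HasDerivAt χ₁ (χ₂ z) z) (h₂ : HasDerivAt χ₂ c y) (hinj : Function.Injective χ)
    (ha : χ₁ y ≠ 0) (t : ℝ) :
    IsThermalTensor K s β χ y t ↔
      t = -(schwarzian (χ₁ y) (χ₂ y) c / (24 * Real.pi)) + χ₁ y ^ 2 * thermalValue β := by
  refine isRenormalizedValue_iff (fun ε hε => isCutoffLimit_thermalMean hβ (h₀ y) (h₀ (y + ε))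
    fun h => hε (by simpa using hinj h)) ?_ t
  have h := (tendsto_point_splitting h₀ h₁ h₂ hinj ha).const_mul (-(1 / (4 * Real.pi)))
  have hy : Tendsto (fun ε : ℝ => y + ε) (𝓝[≠] 0) (𝓝 y) := by
    have : ContinuousAt (fun ε : ℝ => y + ε) 0 := by fun_prop
    simpa using this.tendsto.mono_left nhdsWithin_le_nhds
  have hχ₁ : Tendsto (fun ε => χ₁ (y + ε)) (𝓝[≠] 0) (𝓝 (χ₁ y)) :=
    (h₁ y).continuousAt.tendsto.comp hy
  have hΔ : Tendsto (fun ε => χ (y + ε) - χ y) (𝓝[≠] 0) (𝓝 0) := by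
    simpa using ((h₀ y).continuousAt.tendsto.comp hy).sub_const (χ y)
  have hth := (hχ₁.const_mul (χ₁ y)).mul
    (((tendsto_thermalKernel hβ).comp hΔ).const_mul (1 / (2 * Real.pi)))
  convert! h.add hth using 1
  · funext ε
    simp only [Function.comp_apply]
    rw [mul_sub, ← div_div, ← div_div]
    ring
  · congr 1
    unfold thermalValue
    have := Real.pi_ne_zero
    field_simp
    ring

end Schwarzian

/-! ### The black-hole charts -/

/-- First derivative of the chart. -/
noncomputable def Model.chart₁ : Model → ℝ → ℝ
  | .relativistic => fun y => Real.exp (-y)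
  | .cghs => fun y => (1 + Real.exp y)⁻¹

/-- Second derivative of the chart. -/
noncomputable def Model.chart₂ : Model → ℝ → ℝ
  | .relativistic => fun y => -Real.exp (-y)
  | .cghs => fun y => -(Real.exp y / (1 + Real.exp y) ^ 2)

/-- Third derivative of the chart. -/
noncomputable def Model.chart₃ : Model → ℝ → ℝ
  | .relativistic => fun y => Real.exp (-y)
  | .cghs => fun y => (Real.exp y ^ 2 - Real.exp y) / (1 + Real.exp y) ^ 3

theorem hasDerivAt_exp_neg (y : ℝ) : HasDerivAt (fun y => Real.exp (-y)) (-Real.exp (-y)) y := by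
  simpa using (hasDerivAt_neg y).exp

theorem Model.hasDerivAt_chart (m : Model) (y : ℝ) : HasDerivAt m.chart (m.chart₁ y) y := by
  cases m
  · convert! (hasDerivAt_exp_neg y).neg using 1
    exact (neg_neg _).symm
  · have hpos : 0 < 1 + Real.exp (-y) := by positivity
    convert! (((hasDerivAt_exp_neg y).const_add 1).log hpos.ne').neg using 1
    have := Real.exp_pos y
    simp only [Model.chart₁, Real.exp_neg] at *
    field_simp
    ring

theorem Model.hasDerivAt_chart₁ (m : Model) (y : ℝ) : HasDerivAt m.chart₁ (m.chart₂ y) y := by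
  cases m
  · exact hasDerivAt_exp_neg y
  · have hpos : 0 < 1 + Real.exp y := by positivity
    convert! ((Real.hasDerivAt_exp y).const_add 1).inv hpos.ne' using 1
    simp only [Model.chart₂]
    ring

theorem Model.hasDerivAt_chart₂ (m : Model) (y : ℝ) : HasDerivAt m.chart₂ (m.chart₃ y) y := by
  cases m
  · convert! (hasDerivAt_exp_neg y).neg using 1
    exact (neg_neg _).symm
  · have hpos : 0 < 1 + Real.exp y := by positivity
    convert! ((Real.hasDerivAt_exp y).div (((Real.hasDerivAt_exp y).const_add 1).pow 2)
      (pow_ne_zero 2 hpos.ne')).neg using 1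
    simp only [Model.chart₃, Pi.pow_apply]
    field_simp
    ring

theorem Model.chart₁_pos (m : Model) (y : ℝ) : 0 < m.chart₁ y := by
  cases m <;> simp only [Model.chart₁] <;> positivity

theorem Model.chart_injective (m : Model) : Function.Injective m.chart := by
  refine (strictMono_of_deriv_pos fun y => ?_).injective
  rw [(m.hasDerivAt_chart y).deriv]
  exact m.chart₁_pos y

/-- The vacuum energy-momentum tensor of the model. -/
noncomputable def Model.vacuumTensor : Model → ℝ → ℝ
  | .relativistic => fun _ => 1 / (48 * Real.pi)
  | .cghs => fun y => 1 / (48 * Real.pi) * (1 - (Model.chart₁ .cghs y) ^ 2)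

/-- In the relativistic model the ratios of the second and third derivatives to the first are $-1$
and $1$. In the CGHS model, with $p=\chi'$, they are $-(1-p)$ and $(1-p)(1-2p)$, so the Schwarzian
is $-\frac12(1-p^2)$. -/
theorem Model.schwarzian_chart (m : Model) (y : ℝ) :
    -(schwarzian (m.chart₁ y) (m.chart₂ y) (m.chart₃ y) / (24 * Real.pi)) = m.vacuumTensor y := by
  have hpi := Real.pi_ne_zero
  cases m
  · have := Real.exp_pos (-y)
    simp only [Model.chart₁, Model.chart₂, Model.chart₃, Model.vacuumTensor, schwarzian]
    field_simp
    ring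
  · have := Real.exp_pos y
    simp only [Model.chart₁, Model.chart₂, Model.chart₃, Model.vacuumTensor, schwarzian]
    field_simp
    ring

theorem Model.tendsto_chart₁_atTop (m : Model) : Tendsto m.chart₁ atTop (𝓝 0) := by
  cases m
  · exact Real.tendsto_exp_neg_atTop_nhds_zero
  · exact tendsto_inv_atTop_zero.comp (tendsto_atTop_add_const_left _ _ Real.tendsto_exp_atTop)

theorem Model.tendsto_chart₁_cghs_atBot : Tendsto (Model.chart₁ .cghs) atBot (𝓝 1) := by
  have h := (Real.tendsto_exp_atBot.const_add 1).inv₀ (by norm_num)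
  rwa [add_zero, inv_one] at h

theorem Model.tendsto_vacuumTensor_atTop (m : Model) :
    Tendsto m.vacuumTensor atTop (𝓝 (1 / (48 * Real.pi))) := by
  cases m
  · exact tendsto_const_nhds
  · have h := (((Model.tendsto_chart₁_atTop .cghs).pow 2).const_sub 1).const_mul
      (1 / (48 * Real.pi))
    rwa [zero_pow two_ne_zero, sub_zero, mul_one] at h

theorem Model.tendsto_vacuumTensor_cghs_atBot :
    Tendsto (Model.vacuumTensor .cghs) atBot (𝓝 0) := by
  have h := ((Model.tendsto_chart₁_cghs_atBot.pow 2).const_sub 1).const_mul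
    (1 / (48 * Real.pi))
  rwa [one_pow, sub_self, mul_zero] at h

theorem thermalValue_two_pi : thermalValue (2 * Real.pi) = 1 / (48 * Real.pi) := by
  unfold thermalValue
  have := Real.pi_ne_zero
  field_simp
  norm_num

theorem isThermalTensor_id_iff {K : FieldKind} {s : Scheme} {β : ℝ} (hβ : 0 < β) (y t : ℝ) :
    IsThermalTensor K s β id y t ↔ t = thermalValue β := by
  have h := isThermalTensor_iff (K := K) (s := s) (y := y) hβ (χ₁ := fun _ => 1)
    (χ₂ := fun _ => 0) (fun z => hasDerivAt_id z) (fun z => hasDerivAt_const z 1)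
    (hasDerivAt_const y 0) Function.injective_id one_ne_zero t
  simpa [schwarzian] using h

end BlackHoleRadiation

/-! ### The theorem for both models -/

theorem mainTheorem3 (K : BlackHoleRadiation.FieldKind) (s : BlackHoleRadiation.Scheme) :
    (∀ β : ℝ, 0 < β → ∀ y t : ℝ,
      BlackHoleRadiation.IsThermalTensor K s β id y t ↔ t = BlackHoleRadiation.thermalValue β) ∧
    ∀ (m : BlackHoleRadiation.Model) (β : ℝ), 0 < β →
      ∃ To T : ℝ → ℝ,
        (∀ y t : ℝ, BlackHoleRadiation.IsVacuumTensor K s m.chart y t ↔ t = To y) ∧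
        (∀ y t : ℝ, BlackHoleRadiation.IsThermalTensor K s β m.chart y t ↔ t = T y) ∧
        (∀ y : ℝ, T y = To y + deriv m.chart y ^ 2 * BlackHoleRadiation.thermalValue β) ∧
        Filter.Tendsto T Filter.atTop
          (nhds (BlackHoleRadiation.thermalValue (2 * Real.pi))) ∧
        (m = BlackHoleRadiation.Model.cghs →
          Filter.Tendsto T Filter.atBot (nhds (BlackHoleRadiation.thermalValue β))) := by
  refine ⟨fun β hβ => BlackHoleRadiation.isThermalTensor_id_iff hβ, fun m β hβ =>
    ⟨m.vacuumTensor,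
      fun y => m.vacuumTensor y + m.chart₁ y ^ 2 * BlackHoleRadiation.thermalValue β,
      fun y t => ?_, fun y t => ?_, fun y => ?_, ?_, ?_⟩⟩
  · rw [← m.schwarzian_chart]
    exact BlackHoleRadiation.isVacuumTensor_iff m.hasDerivAt_chart m.hasDerivAt_chart₁
      (m.hasDerivAt_chart₂ y) m.chart_injective (m.chart₁_pos y).ne' t
  · simp only [← m.schwarzian_chart]
    exact BlackHoleRadiation.isThermalTensor_iff hβ m.hasDerivAt_chart m.hasDerivAt_chart₁
      (m.hasDerivAt_chart₂ y) m.chart_injective (m.chart₁_pos y).ne' t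
  · rw [(m.hasDerivAt_chart y).deriv]
  · rw [BlackHoleRadiation.thermalValue_two_pi]
    -- The thermal term carries $\chi'^2\to0$: infinite redshift removes the incoming temperature.
    simpa using m.tendsto_vacuumTensor_atTop.add ((m.tendsto_chart₁_atTop.pow 2).mul_const
      (BlackHoleRadiation.thermalValue β))
  · rintro rfl
    -- Here $\chi'\to1$, so the incoming thermal flux passes through unchanged.
    simpa using BlackHoleRadiation.Model.tendsto_vacuumTensor_cghs_atBot.add
      ((BlackHoleRadiation.Model.tendsto_chart₁_cghs_atBot.pow 2).mul_const
        (BlackHoleRadiation.thermalValue β))
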